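/- An AGW graph is a finite strongly connected directed graph (parallel edges and loops allowed) in which all vertices have the same outdegree $d$ and the greatest common divisor of the lengths of all cycles is one. A coloring of it is a labelling of the edges by $d$ colors such that the $d$ edges leaving any given vertex carry distinct colors; it turns the graph into a complete deterministic automaton whose states are the vertices and whose letters are the colors, and $\mathbf{p}s$ denotes the state reached from $\mathbf{p}$ along the path labelled by the word $s$. States $\mathbf{p},\mathbf{q}$ are synchronized if $\mathbf{p}s=\mathbf{q}s$ for some nonempty word $s$. A pair of distinct states $\mathbf{p},\mathbf{q}$ is stable if for every word $u$ (including the empty one) the states $\mathbf{p}u,\mathbf{q}u$ are synchronized. Theorem. Every AGW graph with more than one vertex has a coloring for which there is a stable pair of distinct states. -/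

import Mathlib

universe u v

namespace RoadColoring

/-- `IsAGW V d`: the directed multigraph `V` (a quiver: vertices in `V`, edges from `a` to `b` in
`a ⟶ b`, so that loops and parallel edges are possible) is a finite strongly connected graph, all
of whose vertices have outdegree `d`, such that the greatest common divisor of the lengths of all
its cycles is one. Cycles are closed paths; these decompose into simple cycles, so that the common
divisors are the same if only the simple cycles of positive length are considered. -/
structure IsAGW (V : Type u) [Quiver.{v} V] (d : ℕ) : Prop where
  finite_vertices : Finite V
  finite_edges : ∀ a b : V, Finite (a ⟶ b)
  strongly_connected : Quiver.IsStronglyConnected V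
  outdegree : ∀ a : V, Nat.card (Quiver.Star a) = d
  gcd_cycles : ∀ k : ℕ, (∀ (a : V) (c : Quiver.Path a a), k ∣ c.length) → k = 1

/-- A coloring of the edges of `V` by the set of colors `C` that turns the graph into a
deterministic complete automaton: the edges that leave a given vertex carry every color exactly
once. -/
structure Coloring (V : Type u) [Quiver.{v} V] (C : Type*) where
  color : ∀ a : V, Quiver.Star a ≃ C

namespace Coloring

variable {V : Type u} [Quiver.{v} V] {C : Type*}

/-- The state reached from `p` along the edge of color `c`. -/
def step (χ : Coloring V C) (p : V) (c : C) : V :=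
  ((χ.color p).symm c).1

/-- The state `ps` reached from `p` along the path labeled by the word `s`. -/
def run (χ : Coloring V C) (p : V) (s : List C) : V :=
  s.foldl χ.step p

/-- The states `p` and `q` are mapped to the same state by some nonempty word. -/
def Synchronizing (χ : Coloring V C) (p q : V) : Prop :=
  ∃ s : List C, s ≠ [] ∧ χ.run p s = χ.run q s

/-- The pair `p`, `q` is synchronizing, and it remains so after any word `u` has been applied. -/
def Stable (χ : Coloring V C) (p q : V) : Prop :=
  χ.Synchronizing p q ∧ ∀ u : List C, χ.Synchronizing (χ.run p u) (χ.run q u)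

end Coloring

end RoadColoring

/-!
The proof follows Trahtman's solution of the road coloring problem, in two independent halves.

*Automata.* Take a word whose image (the set of states it leads to) has the least possible number
of states. Every word acts injectively on such a minimal image and maps it to another one. If two
minimal images differ in a single state each, these two states form a stable pair
(`Coloring.IsMinimalImage.stable`). Now look at the functional graph of one letter `c`: cycles with
trees attached. Suppose that all vertices of maximal level, that is, of maximal distance to the
cycles, lie in one tree, and that this level is positive (`UniqueTop`). By strong connectedness some
minimal image contains such a vertex, and only one, since a power of `c` merges all of them. Applying
`c` until this vertex is one step away from its cycle, and then a power of `c` that fixes the cycles,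
produces two minimal images that differ in a single state
(`Coloring.exists_stable_of_uniqueTop`).

*Graphs.* If all edges from two distinct vertices end at one and the same vertex, then the two
vertices are a stable pair for every coloring. Otherwise some selection of one outgoing edge at
every vertex has a functional graph with `UniqueTop` (`exists_isSelection_uniqueTop`), and every
selection is the action of a letter of some coloring. To find it, start with a selection `f` that has
the maximal number of vertices on cycles. If `f` is a permutation, redirecting one edge suffices;
here the condition on the greatest common divisor enters, to ensure that there is an edge not
selected by `f`. Otherwise let `p` be a vertex of maximal level, `r` its root, and redirect to `p`
the edge selected at some predecessor `t` of `p`. If the orbit of `p` avoids `t`, the tree of `p`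
becomes the unique highest one. If `t` lies on the branch from `p` to `r`, a new cycle arises and
contradicts maximality. If `t` lies on the cycle of `r`, the segment of the cycle between `t` and `r`
is exchanged for the branch from `p` to `r` (`Exchange`); maximality excludes a segment shorter than
the branch, and a longer segment becomes a unique highest branch. There remains the case of equal
lengths. The last vertices before `r` of the branch and of the segment do not both have `r` as their
only successor, and by symmetry the last vertex of the branch may be assumed to have a successor
different from `r`. Redirecting the branch there either gives a unique highest tree, or
moves the root of `p` along the cycles, whereby the equality of lengths is lost.
-/

namespace RoadColoring

open Function

/-! ### Levels in a functional graph -/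

section Dynamics

variable {V : Type*} {f : V → V} {x y t : V}

theorem iterate_mem_periodicPts (hx : x ∈ periodicPts f) (n : ℕ) : f^[n] x ∈ periodicPts f := by
  obtain ⟨N, hN, h⟩ := hx
  exact ⟨N, hN, h.apply_iterate n⟩

theorem iterate_mem_periodicPts_of_le {m n : ℕ} (h : m ≤ n) (hx : f^[m] x ∈ periodicPts f) :
    f^[n] x ∈ periodicPts f := by
  obtain ⟨k, rfl⟩ := Nat.exists_eq_add_of_le' h
  rw [iterate_add_apply]
  exact iterate_mem_periodicPts hx k

theorem exists_iterate_iterate_eq (hx : x ∈ periodicPts f) (n : ℕ) : ∃ m, f^[m] (f^[n] x) = x := by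
  obtain ⟨N, hN, h⟩ := hx
  refine ⟨N * n - n, ?_⟩
  rw [← iterate_add_apply, Nat.sub_add_cancel (Nat.le_mul_of_pos_left n hN)]
  exact h.mul_const n

theorem exists_iterate_mem_periodicPts [Finite V] (f : V → V) (x : V) :
    ∃ n, f^[n] x ∈ periodicPts f := by
  obtain ⟨i, j, hne, hij⟩ := Finite.exists_ne_map_eq_of_infinite (fun n : ℕ => f^[n] x)
  wlog h : i < j generalizing i j
  · exact this j i hne.symm hij.symm (by omega)
  refine ⟨i, j - i, by omega, ?_⟩
  change f^[j - i] (f^[i] x) = f^[i] x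
  rw [← iterate_add_apply, Nat.sub_add_cancel h.le]
  exact hij.symm

theorem iterate_injOn_transient {l : ℕ} (hx : f^[l] x ∉ periodicPts f) :
    Set.InjOn (fun i => f^[i] x) (Set.Iic l) := by
  intro i hi j hj hij
  by_contra hne
  wlog h : i < j generalizing i j
  · exact this hj hi hij.symm (Ne.symm hne) (by omega)
  refine hx (iterate_mem_periodicPts_of_le hi ⟨j - i, by omega, ?_⟩)
  change f^[j - i] (f^[i] x) = f^[i] x
  rw [← iterate_add_apply, Nat.sub_add_cancel h.le]
  exact hij.symm

/-- The orbit of `x` enters the set of periodic points at `r`: in the functional graph of `f`,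
`r` is the root of the tree that contains `x`. -/
def EntersAt (f : V → V) (x r : V) : Prop :=
  r ∈ periodicPts f ∧ ∃ n, f^[n] x = r ∧ ∀ i < n, f^[i] x ∉ periodicPts f

theorem EntersAt.of_iterate {r : V} {n : ℕ} (h : EntersAt f (f^[n] x) r)
    (hn : ∀ i < n, f^[i] x ∉ periodicPts f) : EntersAt f x r := by
  obtain ⟨hr, m, hm, hi⟩ := h
  refine ⟨hr, m + n, by rw [iterate_add_apply, hm], fun i hin => ?_⟩
  rcases lt_or_ge i n with h | h
  · exact hn i h
  · obtain ⟨j, rfl⟩ := Nat.exists_eq_add_of_le' h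
    rw [iterate_add_apply]
    exact hi j (by omega)

/-- All vertices of maximal positive level `L + 1` in the functional graph of `f` lie in one tree,
with root `r`. -/
def UniqueTop (f : V → V) : Prop :=
  ∃ L r p, r ∈ periodicPts f ∧ f^[L] p ∉ periodicPts f ∧
    ∀ q, f^[L] q ∉ periodicPts f → f^[L + 1] q = r

theorem exists_height [Finite V] (f : V → V) (h : ∃ p, p ∉ periodicPts f) :
    ∃ l, (∀ q, f^[l + 1] q ∈ periodicPts f) ∧ ∃ p, f^[l] p ∉ periodicPts f := by
  classical
  have hex : ∃ M, ∀ q, f^[M] q ∈ periodicPts f := by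
    choose n hn using exists_iterate_mem_periodicPts f
    obtain ⟨M, hM⟩ := (Set.finite_range n).bddAbove
    exact ⟨M, fun q => iterate_mem_periodicPts_of_le (hM ⟨q, rfl⟩) (hn q)⟩
  rcases hl : Nat.find hex with _ | l
  · obtain ⟨p, hp⟩ := h
    have := Nat.find_spec hex p
    rw [hl] at this
    exact absurd this hp
  · refine ⟨l, fun q => ?_, ?_⟩
    · have := Nat.find_spec hex q
      rwa [hl] at this
    · have := Nat.find_min hex (m := l) (by omega)
      push Not at this
      exact this

/-- It suffices that all vertices above some level `L` lie in one tree. -/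
theorem UniqueTop.of_entersAt [Finite V] {L : ℕ} {p r : V} (hp : f^[L] p ∉ periodicPts f)
    (h : ∀ q, f^[L] q ∉ periodicPts f → EntersAt f q r) : UniqueTop f := by
  obtain ⟨l, hl, p', hp'⟩ := exists_height f ⟨_, hp⟩
  have hLl : L ≤ l := by
    by_contra hc
    exact hp (iterate_mem_periodicPts_of_le (by omega) (hl p))
  refine ⟨l, r, p', (h p hp).1, hp', fun q hq => ?_⟩
  obtain ⟨hr, n, hn, hi⟩ := h q fun hc => hq (iterate_mem_periodicPts_of_le hLl hc)
  have h1 : ¬ n ≤ l := fun hc => hq (iterate_mem_periodicPts_of_le hc (hn ▸ hr))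
  have h2 : ¬ l + 1 < n := fun hc => hi _ hc (hl q)
  rw [← hn]
  congr 2
  omega

/-! ### Redirecting one edge of a functional graph -/

variable [DecidableEq V]

theorem update_iterate {n : ℕ} (h : ∀ i < n, f^[i] x ≠ t) : (update f t y)^[n] x = f^[n] x := by
  induction n with
  | zero => rfl
  | succ n ih =>
    rw [iterate_succ_apply', iterate_succ_apply', ih fun i hi => h i (by omega),
      update_of_ne (h n (by omega))]

theorem mem_periodicPts_update_iff (h : ∀ n, f^[n] x ≠ t) :
    x ∈ periodicPts (update f t y) ↔ x ∈ periodicPts f := by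
  simp only [mem_periodicPts, IsPeriodicPt, IsFixedPt,
    fun n => update_iterate (f := f) (x := x) (y := y) (t := t) (n := n) fun i _ => h i]

theorem iterate_mem_periodicPts_update_iff (h : ∀ n, f^[n] x ≠ t) (n : ℕ) :
    (update f t y)^[n] x ∈ periodicPts (update f t y) ↔ f^[n] x ∈ periodicPts f := by
  rw [update_iterate fun i _ => h i]
  refine mem_periodicPts_update_iff fun m => ?_
  rw [← iterate_add_apply]
  exact h _

/-- The first visit of the orbit of `x` at `t`. -/
theorem exists_first_visit (h : ∃ n, f^[n] x = t) :
    ∃ n, f^[n] x = t ∧ ∀ i < n, f^[i] x ≠ t :=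
  ⟨Nat.find h, Nat.find_spec h, fun _ hi => Nat.find_min h hi⟩

/-- If the orbit of `p` leads to `t`, then sending `t` to `p` closes a cycle. -/
theorem mem_periodicPts_update_of_visit {p : V} (h : ∃ n, f^[n] p = t) :
    p ∈ periodicPts (update f t p) := by
  obtain ⟨n, hn, hi⟩ := exists_first_visit h
  refine ⟨n + 1, by omega, ?_⟩
  change (update f t p)^[n + 1] p = p
  rw [iterate_succ_apply', update_iterate hi, hn, update_self]

/-- If the orbit of `p` avoids `t`, then `t` is not periodic once it has been sent to `p`. -/
theorem notMem_periodicPts_update_of_avoids {p : V} (h : ∀ n, f^[n] p ≠ t) :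
    t ∉ periodicPts (update f t p) := by
  rintro ⟨m, hm, hper⟩
  obtain ⟨m, rfl⟩ := Nat.exists_eq_add_one_of_ne_zero hm.ne'
  have : (update f t p)^[m + 1] t = t := hper
  rw [iterate_succ_apply, update_self, update_iterate fun i _ => h i] at this
  exact h m this

/-- If `p` has level `l + 1`, the maximal one, and `t` is off the orbit of `p`, then sending `t` to
`p` makes the subtree of `t` overtop all other vertices. -/
theorem uniqueTop_update_of_avoids [Finite V] {p : V} {l : ℕ}
    (hl : ∀ q, f^[l + 1] q ∈ periodicPts f) (hp : f^[l] p ∉ periodicPts f)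
    (h : ∀ n, f^[n] p ≠ t) : UniqueTop (update f t p) := by
  have ht := notMem_periodicPts_update_of_avoids h
  have hP := fun n => iterate_mem_periodicPts_update_iff (y := p) h n
  refine UniqueTop.of_entersAt (L := l + 1) (p := t) (r := f^[l + 1] p) ?_ fun q hq => ?_
  · rw [iterate_succ_apply, update_self, hP]
    exact hp
  · by_cases hqt : ∀ n, f^[n] q ≠ t
    · exact absurd ((iterate_mem_periodicPts_update_iff hqt _).2 (hl q)) hq
    · push Not at hqt
      obtain ⟨n, hn, hi⟩ := exists_first_visit hqt
      have hgn : (update f t p)^[n] q = t := by rw [update_iterate hi, hn]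
      have hent : EntersAt (update f t p) p (f^[l + 1] p) := by
        refine ⟨?_, l + 1, update_iterate fun i _ => h i, fun i hi hc => ?_⟩
        · rw [← update_iterate (y := p) fun i (_ : i < l + 1) => h i, hP]
          exact hl p
        · exact hp (iterate_mem_periodicPts_of_le (by omega) ((hP i).1 hc))
      refine EntersAt.of_iterate (n := n + 1) ?_ fun i hi hc => ht ?_
      · rwa [iterate_succ_apply', hgn, update_self]
      · have := iterate_mem_periodicPts_of_le (Nat.le_of_lt_succ hi) hc
        rwa [hgn] at this

/-- Closing a cycle through a vertex `t` that is not periodic increases the number of periodic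
points, since no old cycle is destroyed. -/
theorem ncard_periodicPts_lt_update [Finite V] {p : V} (ht : t ∉ periodicPts f)
    (h : ∃ n, f^[n] p = t) :
    (periodicPts f).ncard < (periodicPts (update f t p)).ncard := by
  have hp := mem_periodicPts_update_of_visit h
  refine Set.ncard_lt_ncard ⟨fun x hx => ?_, fun hc => ht (hc ?_)⟩ (Set.toFinite _)
  · refine (mem_periodicPts_update_iff fun n hn => ht ?_).2 hx
    exact hn ▸ iterate_mem_periodicPts hx n
  · obtain ⟨n, hn, hi⟩ := exists_first_visit h
    have := iterate_mem_periodicPts hp n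
    rwa [update_iterate hi, hn] at this

/-- If `f` is a permutation, redirecting one edge `x → f x` leaves `f x` as the only vertex without
predecessor, so that there is only one branch. -/
theorem uniqueTop_update_of_forall_periodic [Finite V] {s : V}
    (hall : ∀ q, q ∈ periodicPts f) (hs : s ≠ f x) : UniqueTop (update f x s) := by
  have hinj : Injective f := injective_iff_periodicPts_eq_univ.2 (Set.eq_univ_of_forall hall)
  have hfx : f x ∉ periodicPts (update f x s) := by
    intro hc
    obtain ⟨z, hz⟩ := periodicPts_subset_range hc
    by_cases hzx : z = x
    · subst hzx
      exact hs (by simpa using hz)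
    · rw [update_of_ne hzx] at hz
      exact hzx (hinj hz)
  obtain ⟨n, hn, hni⟩ : ∃ n, (update f x s)^[n] (f x) ∈ periodicPts (update f x s) ∧
      ∀ i < n, (update f x s)^[i] (f x) ∉ periodicPts (update f x s) := by
    classical
    have hex := exists_iterate_mem_periodicPts (update f x s) (f x)
    exact ⟨Nat.find hex, Nat.find_spec hex, fun _ hi => Nat.find_min hex hi⟩
  refine UniqueTop.of_entersAt (L := 0) (p := f x) (r := (update f x s)^[n] (f x)) hfx
    fun q hq => ?_
  obtain ⟨m, hm⟩ : ∃ m, f^[m] q = x := by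
    by_contra! hc
    exact hq ((mem_periodicPts_update_iff hc).2 (hall q))
  obtain ⟨j, hj, hji⟩ : ∃ j, f^[j] (f x) = q ∧ ∀ i < j, f^[i] (f x) ≠ q := by
    refine exists_first_visit ?_
    obtain ⟨k, hk⟩ := exists_iterate_iterate_eq (hall q) (m + 1)
    rw [iterate_succ_apply', hm] at hk
    exact ⟨k, hk⟩
  have hgj : (update f x s)^[j] (f x) = q := by
    rw [update_iterate, hj]
    intro i hi hc
    refine hji (j - (i + 1)) (by omega) ?_
    conv_lhs => rw [← hc, ← iterate_succ_apply' f i, ← iterate_add_apply]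
    rw [Nat.sub_add_cancel hi, hj]
  have hjn : j < n := by
    by_contra hc
    exact hq (by simpa [hgj] using iterate_mem_periodicPts_of_le (not_lt.1 hc) hn)
  refine ⟨hn, n - j, ?_, fun i hi => ?_⟩
  · rw [← hgj, ← iterate_add_apply, Nat.sub_add_cancel hjn.le]
  · rw [← hgj, ← iterate_add_apply]
    exact hni _ (by omega)

end Dynamics

/-! ### Exchanging a segment of a cycle for a branch -/

/-- The vertex `p` of the functional graph of `f` has level `l + 1` and root `r`, the vertex `t`
lies on the cycle of `r`, and `k` is the distance from `f t` to `r`. Sending `t` to `p` trades the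
segment of the cycle that leads from `f t` to `r` for the branch that leads from `p` to `r`. -/
structure Exchange {V : Type*} (f : V → V) (p t r : V) (l k : ℕ) : Prop where
  height : ∀ q, f^[l + 1] q ∈ periodicPts f
  notMem : f^[l] p ∉ periodicPts f
  root : f^[l + 1] p = r
  periodic : t ∈ periodicPts f
  visit : ∃ n, f^[n] p = t
  return_eq : f^[k] (f t) = r
  return_ne : ∀ j < k, f^[j] (f t) ≠ r

namespace Exchange

variable {V : Type*} {f : V → V} {p t r : V} {l k : ℕ}

theorem branch_notMem (h : Exchange f p t r l k) {i : ℕ} (hi : i ≤ l) :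
    f^[i] p ∉ periodicPts f :=
  fun hc => h.notMem (iterate_mem_periodicPts_of_le hi hc)

theorem branch_ne (h : Exchange f p t r l k) {i : ℕ} (hi : i < l + 1) : f^[i] p ≠ t :=
  fun hc => h.branch_notMem (Nat.le_of_lt_succ hi) (hc ▸ h.periodic)

theorem root_visit (h : Exchange f p t r l k) : ∃ n, f^[n] r = t := by
  obtain ⟨n, hn⟩ := h.visit
  have hle : l + 1 ≤ n := by
    by_contra hc
    exact h.branch_ne (not_le.1 hc) hn
  refine ⟨n - (l + 1), ?_⟩
  rw [← h.root, ← iterate_add_apply, Nat.sub_add_cancel hle, hn]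

/-- The segment from `f t` to `r` does not contain `t`, except possibly at its end. -/
theorem segment_ne (h : Exchange f p t r l k) {j : ℕ} (hj : j < k) : f^[j] (f t) ≠ t := by
  intro hc
  refine h.return_ne (k - (j + 1)) (by omega) ?_
  have h1 : f^[k - (j + 1)] (f (f^[j] (f t))) = r := by
    rw [← iterate_succ_apply' f j, ← iterate_add_apply, Nat.sub_add_cancel hj, h.return_eq]
  rwa [hc] at h1

variable [DecidableEq V]

theorem iterate_branch (h : Exchange f p t r l k) {j : ℕ} (hj : j ≤ l + 1) :
    (update f t p)^[j] p = f^[j] p :=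
  update_iterate fun _ hi => h.branch_ne (by omega)

theorem iterate_segment (h : Exchange f p t r l k) {j : ℕ} (hj : j ≤ k) :
    (update f t p)^[j] (f t) = f^[j] (f t) :=
  update_iterate fun _ hi => h.segment_ne (by omega)

theorem branch_mem (h : Exchange f p t r l k) {j : ℕ} (hj : j ≤ l + 1) :
    f^[j] p ∈ periodicPts (update f t p) := by
  rw [← h.iterate_branch hj]
  exact iterate_mem_periodicPts (mem_periodicPts_update_of_visit h.visit) j

theorem root_mem_update (h : Exchange f p t r l k) : r ∈ periodicPts (update f t p) :=
  h.root ▸ h.branch_mem le_rfl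

/-- Only the points of the segment from `f t` to `r` can cease to be periodic. -/
theorem exists_segment_eq (h : Exchange f p t r l k) {x : V} (hx : x ∈ periodicPts f)
    (hx' : x ∉ periodicPts (update f t p)) : ∃ j < k, f^[j] (f t) = x := by
  obtain ⟨n, hn⟩ : ∃ n, f^[n] x = t := by
    by_contra! hc
    exact hx' ((mem_periodicPts_update_iff hc).2 hx)
  obtain ⟨n', hn'⟩ := h.root_visit
  obtain ⟨m, hm, hmi⟩ : ∃ m, f^[m] r = x ∧ ∀ i < m, f^[i] r ≠ x := by
    refine exists_first_visit ?_
    obtain ⟨a, ha⟩ := exists_iterate_iterate_eq hx n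
    refine ⟨a + n', ?_⟩
    rw [iterate_add_apply, hn', ← hn, ha]
  obtain ⟨i, hi, hit⟩ : ∃ i < m, f^[i] r = t := by
    by_contra! hc
    apply hx'
    rw [← hm, ← update_iterate hc]
    exact iterate_mem_periodicPts h.root_mem_update m
  have hseg : ∀ j, f^[j] (f t) = f^[j + (i + 1)] r := fun j => by
    rw [iterate_add_apply, iterate_succ_apply', hit]
  refine ⟨m - (i + 1), ?_, by rw [hseg, Nat.sub_add_cancel hi, hm]⟩
  by_contra hc
  have hk : f^[k + (i + 1)] r = r := by rw [← hseg, h.return_eq]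
  refine hmi (m - (k + (i + 1))) (by omega) ?_
  conv_lhs => rw [← hk]
  rw [← iterate_add_apply, Nat.sub_add_cancel (by omega), hm]

/-- Every point of the segment from `f t` to `r` ceases to be periodic: the new cycle consists of the
initial part, up to `t`, of the orbit of `p`. -/
theorem segment_notMem (h : Exchange f p t r l k) {j : ℕ} (hj : j < k) :
    f^[j] (f t) ∉ periodicPts (update f t p) := by
  intro hc
  have hinit : ∀ m, ∃ i, f^[i] p = (update f t p)^[m] r ∧ ∀ i' < i, f^[i'] p ≠ t := by
    intro m
    induction m with
    | zero => exact ⟨l + 1, h.root, fun i' hi' => h.branch_ne hi'⟩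
    | succ m ih =>
      obtain ⟨i, hi, hi'⟩ := ih
      rw [iterate_succ_apply', ← hi]
      by_cases hit : f^[i] p = t
      · exact ⟨0, by rw [hit, update_self, iterate_zero_apply], by simp⟩
      · refine ⟨i + 1, by rw [update_of_ne hit, iterate_succ_apply'], fun i' hlt => ?_⟩
        rcases Nat.lt_succ_iff_lt_or_eq.1 hlt with hlt | rfl
        · exact hi' i' hlt
        · exact hit
  have hret : f^[k - j] (f^[j] (f t)) = r := by
    rw [← iterate_add_apply, Nat.sub_add_cancel hj.le, h.return_eq]
  have hret' : (update f t p)^[k - j] (f^[j] (f t)) = r := by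
    rw [← h.iterate_segment hj.le, ← iterate_add_apply, Nat.sub_add_cancel hj.le,
      h.iterate_segment le_rfl, h.return_eq]
  obtain ⟨m, hm⟩ := exists_iterate_iterate_eq hc (k - j)
  rw [hret'] at hm
  obtain ⟨i, hi, hne⟩ := hinit m
  rw [hm] at hi
  have hli : l + 1 ≤ i := by
    by_contra hc'
    refine h.branch_notMem (i := i) (by omega) (hi ▸ ?_)
    exact iterate_mem_periodicPts (iterate_mem_periodicPts h.periodic 1) j
  obtain ⟨e, rfl⟩ := Nat.exists_eq_add_of_le' hli
  have hbranch : ∀ e, f^[e + (l + 1)] p = f^[e] r := fun e => by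
    rw [iterate_add_apply, h.root]
  rw [hbranch] at hi
  -- the cycle of `r` splits into the parts from `r` to `f^[j] (f t)` and back, and neither of
  -- them contains `t`
  have hper : IsPeriodicPt f (k - j + e) r := by
    change f^[_] r = r
    rw [iterate_add_apply, hi, hret]
  obtain ⟨n', hn'⟩ := h.root_visit
  obtain ⟨n, hn, hlt⟩ : ∃ n, f^[n] r = t ∧ n < k - j + e :=
    ⟨_, by rw [hper.iterate_mod_apply, hn'], Nat.mod_lt n' (by omega)⟩
  rcases lt_or_ge n e with hcase | hcase
  · exact hne (n + (l + 1)) (by omega) (by rw [hbranch, hn])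
  · refine h.segment_ne (j := n - e + j) (by omega) ?_
    rw [iterate_add_apply, ← hi, ← iterate_add_apply, Nat.sub_add_cancel hcase, hn]

theorem ncard_add_le [Finite V] (h : Exchange f p t r l k) :
    (periodicPts f).ncard + (l + 1) ≤ (periodicPts (update f t p)).ncard + k := by
  have hbr : ((fun i => f^[i] p) '' Set.Iic l).ncard = l + 1 := by
    rw [(iterate_injOn_transient h.notMem).ncard_image, Set.ncard_eq_toFinset_card']
    simp
  have hseg : ((fun j => f^[j] (f t)) '' Set.Iio k).ncard ≤ k := by
    refine (Set.ncard_image_le (Set.toFinite _)).trans ?_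
    rw [Set.ncard_eq_toFinset_card']
    simp
  rw [← hbr, ← Set.ncard_union_eq]
  · refine (Set.ncard_le_ncard ?_ (Set.toFinite _)).trans ((Set.ncard_union_le _
      ((fun j => f^[j] (f t)) '' Set.Iio k)).trans (Nat.add_le_add_left hseg _))
    rintro x (hx | ⟨i, hi, rfl⟩)
    · by_cases hx' : x ∈ periodicPts (update f t p)
      · exact Or.inl hx'
      · obtain ⟨j, hj, rfl⟩ := h.exists_segment_eq hx hx'
        exact Or.inr ⟨j, hj, rfl⟩
    · exact Or.inl (h.branch_mem (Nat.le_succ_of_le hi))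
  · rw [Set.disjoint_right]
    rintro _ ⟨i, hi, rfl⟩
    exact h.branch_notMem hi

/-- After the exchange, only branches over the former segment of the cycle can be longer than
`l + 1`, and they enter the new cycle at `r`. -/
theorem entersAt (h : Exchange f p t r l k) {q : V}
    (hq : (update f t p)^[l + 1] q ∉ periodicPts (update f t p)) :
    EntersAt (update f t p) q r := by
  classical
  obtain ⟨n, hn, hni⟩ : ∃ n, f^[n] q ∈ periodicPts f ∧ ∀ i < n, f^[i] q ∉ periodicPts f := by
    have hex : ∃ n, f^[n] q ∈ periodicPts f := ⟨_, h.height q⟩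
    exact ⟨Nat.find hex, Nat.find_spec hex, fun _ hi => Nat.find_min hex hi⟩
  have hnl : n ≤ l + 1 := by
    by_contra hc
    exact hni _ (not_le.1 hc) (h.height q)
  have hgn : (update f t p)^[n] q = f^[n] q :=
    update_iterate fun i hi hc => hni i hi (hc ▸ h.periodic)
  have hx : (update f t p)^[n] q ∉ periodicPts (update f t p) :=
    fun hc => hq (iterate_mem_periodicPts_of_le hnl hc)
  obtain ⟨j, hj, hjx⟩ := h.exists_segment_eq hn (hgn ▸ hx)
  refine EntersAt.of_iterate (n := n) ⟨h.root_mem_update, k - j, ?_, fun i hi => ?_⟩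
    fun i hi hc => hx (iterate_mem_periodicPts_of_le hi.le hc)
  · rw [hgn, ← hjx, ← h.iterate_segment hj.le, ← iterate_add_apply, Nat.sub_add_cancel hj.le,
      h.iterate_segment le_rfl, h.return_eq]
  · rw [hgn, ← hjx, ← h.iterate_segment hj.le, ← iterate_add_apply, h.iterate_segment (by omega)]
    exact h.segment_notMem (by omega)

theorem uniqueTop_update [Finite V] (h : Exchange f p t r l k) {q : V}
    (hq : (update f t p)^[l + 1] q ∉ periodicPts (update f t p)) : UniqueTop (update f t p) :=
  UniqueTop.of_entersAt hq fun _ => h.entersAt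

end Exchange

/-! ### A selection of edges with a single highest tree -/

section Selection

variable {V : Type*}

/-- The map `f` selects one outgoing edge at every vertex of the graph with adjacency `E`. -/
def IsSelection (E : V → V → Prop) (f : V → V) : Prop := ∀ x, E x (f x)

/-- A selection with the largest possible number of vertices on cycles. -/
def IsMaximalSelection (E : V → V → Prop) (f : V → V) : Prop :=
  IsSelection E f ∧ ∀ g, IsSelection E g → (periodicPts g).ncard ≤ (periodicPts f).ncard

theorem IsSelection.update [DecidableEq V] {E : V → V → Prop} {f : V → V} (hf : IsSelection E f)
    {x y : V} (h : E x y) : IsSelection E (update f x y) := by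
  intro z
  by_cases hz : z = x
  · subst hz
    rwa [update_self]
  · rw [update_of_ne hz]
    exact hf z

theorem exists_isMaximalSelection [Finite V] {E : V → V → Prop} (hE : ∀ x, ∃ y, E x y) :
    ∃ f, IsMaximalSelection E f := by
  choose f hf using hE
  obtain ⟨g, hg, hmax⟩ := (Set.toFinite {g | IsSelection E g}).exists_maximalFor
    (fun g => (periodicPts g).ncard) _ ⟨f, hf⟩
  exact ⟨g, hg, fun g' hg' => (le_total _ _).elim id fun h => hmax hg' h⟩

variable [Finite V] [DecidableEq V] {E : V → V → Prop} {f : V → V} {p t : V} {l : ℕ}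

theorem IsMaximalSelection.mem_of_visit (hf : IsMaximalSelection E f) (h : E t p)
    (hv : ∃ n, f^[n] p = t) : t ∈ periodicPts f := by
  by_contra hc
  exact (hf.2 _ (hf.1.update h)).not_gt (ncard_periodicPts_lt_update hc hv)

/-- If no selection has a unique highest tree, then for a vertex `p` of maximal level every edge
into `p` starts on the cycle below `p`, and the segment that can be exchanged for the branch of `p`
has exactly the length of the branch. -/
theorem IsMaximalSelection.exchange (hf : IsMaximalSelection E f)
    (hno : ∀ g, IsSelection E g → ¬ UniqueTop g) (hl : ∀ q, f^[l + 1] q ∈ periodicPts f)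
    (hp : f^[l] p ∉ periodicPts f) (h : E t p) :
    Exchange f p t (f^[l + 1] p) l (l + 1) := by
  have hg := hf.1.update h
  have hv : ∃ n, f^[n] p = t := by
    by_contra! hc
    exact hno _ hg (uniqueTop_update_of_avoids hl hp hc)
  have ht := hf.mem_of_visit h hv
  have hret : ∃ m, f^[m] (f t) = f^[l + 1] p := by
    obtain ⟨n, rfl⟩ := hv
    obtain ⟨m, hm⟩ := exists_iterate_iterate_eq (hl p) (n + 1)
    refine ⟨m + (l + 1), ?_⟩
    conv_rhs => rw [← hm]
    rw [← iterate_succ_apply' f n, ← iterate_add_apply, ← iterate_add_apply, ← iterate_add_apply]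
    congr 1
    omega
  obtain ⟨k, hk, hki⟩ := exists_first_visit hret
  have hex : Exchange f p t (f^[l + 1] p) l k := ⟨hl, hp, rfl, ht, hv, hk, hki⟩
  have hle : l + 1 ≤ k := by
    have h1 := hex.ncard_add_le
    have h2 := hf.2 _ hg
    omega
  rcases hle.lt_or_eq with hlt | rfl
  · refine absurd (hex.uniqueTop_update (q := f t) ?_) (hno _ hg)
    rw [hex.iterate_segment hle]
    exact hex.segment_notMem hlt
  · exact hex

/-- A maximal selection in which the last vertex off the cycle on the branch of a highest vertex has
a second out-neighbor yields a selection with a unique highest tree: moving the end of the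
branch to another point of the cycle would destroy the equality of lengths. -/
theorem IsMaximalSelection.exists_uniqueTop_of_second_edge (hf : IsMaximalSelection E f)
    (hin : ∃ t, E t p) (hl : ∀ q, f^[l + 1] q ∈ periodicPts f) (hp : f^[l] p ∉ periodicPts f)
    {s : V} (hs : E (f^[l] p) s) (hne : s ≠ f^[l + 1] p) :
    ∃ g, IsSelection E g ∧ UniqueTop g := by
  by_contra! hno
  obtain ⟨t, htp⟩ := hin
  have hex := hf.exchange hno hl hp htp
  have hsel := hf.1.update hs
  have hav : ∀ n, f^[n] s ≠ f^[l] p := by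
    by_contra! hc
    exact hp (hf.mem_of_visit hs hc)
  have hbr : ∀ i ≤ l, (update f (f^[l] p) s)^[i] p = f^[i] p := fun i hi =>
    update_iterate fun j hj hc => by
      have := iterate_injOn_transient hp (Set.mem_Iic.2 (by omega : j ≤ l)) Set.self_mem_Iic hc
      omega
  have hbr' : ∀ i, (update f (f^[l] p) s)^[i + (l + 1)] p = f^[i] s := fun i => by
    rw [iterate_add_apply, iterate_succ_apply', hbr l le_rfl, update_self,
      update_iterate fun i _ => hav i]
  have hp' := notMem_periodicPts_update_of_avoids hav
  have hsP := fun n => iterate_mem_periodicPts_update_iff (y := s) hav n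
  -- the orbit of a vertex either is unchanged or leads through `f^[l] p`
  have hcase : ∀ q, (∀ n, f^[n] q ≠ f^[l] p) ∨ ∃ n ≤ l, (update f (f^[l] p) s)^[n] q = f^[l] p := by
    intro q
    by_cases hq : ∃ n, f^[n] q = f^[l] p
    · obtain ⟨n, hn, hni⟩ := exists_first_visit hq
      refine Or.inr ⟨n, ?_, by rw [update_iterate hni, hn]⟩
      by_contra hc
      exact hp (hn ▸ iterate_mem_periodicPts_of_le (not_le.1 hc) (hl q))
    · push Not at hq
      exact Or.inl hq
  by_cases hsper : s ∈ periodicPts f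
  · have hP : ∀ x, x ∈ periodicPts f → ∀ n, f^[n] x ≠ f^[l] p :=
      fun x hx n hc => hp (hc ▸ iterate_mem_periodicPts hx n)
    have hmax : IsMaximalSelection E (update f (f^[l] p) s) := by
      refine ⟨hsel, fun g hg => (hf.2 g hg).trans (Set.ncard_le_ncard (fun x hx => ?_)
        (Set.toFinite _))⟩
      exact (mem_periodicPts_update_iff (hP x hx)).2 hx
    have hl' : ∀ q, (update f (f^[l] p) s)^[l + 1] q ∈ periodicPts (update f (f^[l] p) s) := by
      intro q
      rcases hcase q with hq | ⟨n, hn, hnq⟩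
      · exact (iterate_mem_periodicPts_update_iff hq _).2 (hl q)
      · refine iterate_mem_periodicPts_of_le (m := n + 1) (by omega) ?_
        rw [iterate_succ_apply', hnq, update_self]
        exact (hsP 0).2 hsper
    have hex' := hmax.exchange hno hl' (by rwa [hbr l le_rfl]) htp
    have hret := hex'.return_eq
    have hzero := hbr' 0
    rw [Nat.zero_add] at hzero
    have hne' : t ≠ f^[l] p := fun hc => hp (hc ▸ hex.periodic)
    have hft : f t ∈ periodicPts f := iterate_mem_periodicPts hex.periodic 1
    rw [hzero, update_of_ne hne', update_iterate fun i _ => hP _ hft i, hex.return_eq] at hret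
    exact hne hret.symm
  · refine hno _ hsel ?_
    classical
    obtain ⟨n, hn, hni⟩ : ∃ n, f^[n] s ∈ periodicPts f ∧ ∀ i < n, f^[i] s ∉ periodicPts f := by
      have hfin := exists_iterate_mem_periodicPts f s
      exact ⟨Nat.find hfin, Nat.find_spec hfin, fun _ hi => Nat.find_min hfin hi⟩
    refine UniqueTop.of_entersAt (L := l + 1) (p := p) (r := f^[n] s) ?_ fun q hq => ?_
    · rw [← Nat.zero_add (l + 1), hbr']
      exact fun hc => hsper ((hsP 0).1 hc)
    · rcases hcase q with hqa | ⟨m, -, hmq⟩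
      · exact absurd ((iterate_mem_periodicPts_update_iff hqa _).2 (hl q)) hq
      · have hent : EntersAt (update f (f^[l] p) s) s (f^[n] s) := by
          have hit := fun n => update_iterate (y := s) fun i (_ : i < n) => hav i
          refine ⟨?_, n, hit n, fun i hi hc => hni i hi ((hsP i).1 hc)⟩
          rw [← hit n]
          exact (hsP n).2 hn
        refine EntersAt.of_iterate (n := m + 1) ?_ fun i hi hc => hp' ?_
        · rwa [iterate_succ_apply', hmq, update_self]
        · have := iterate_mem_periodicPts_of_le (Nat.le_of_lt_succ hi) hc
          rwa [hmq] at this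

/-- Existence of a selection with a unique highest tree. In a nontrivial strongly connected graph the
hypothesis `hbranch` fails only for a single cycle, possibly with multiple edges, and `hbunch` says
that no two distinct vertices have the same vertex as their only successor. -/
theorem exists_isSelection_uniqueTop (hout : ∀ x, ∃ y, E x y) (hin : ∀ y, ∃ x, E x y)
    (hbranch : ∀ f, IsSelection E f → (∀ q, q ∈ periodicPts f) → ∃ x s, E x s ∧ s ≠ f x)
    (hbunch : ∀ x y r, x ≠ y → E x r → E y r → ∃ s, s ≠ r ∧ (E x s ∨ E y s)) :
    ∃ g, IsSelection E g ∧ UniqueTop g := by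
  obtain ⟨f, hf⟩ := exists_isMaximalSelection hout
  by_cases hall : ∀ q, q ∈ periodicPts f
  · obtain ⟨x, s, hxs, hs⟩ := hbranch f hf.1 hall
    exact ⟨_, hf.1.update hxs, uniqueTop_update_of_forall_periodic hall hs⟩
  push Not at hall
  obtain ⟨l, hl, p, hp⟩ := exists_height f hall
  by_contra! hno
  obtain ⟨t, htp⟩ := hin p
  have hex := hf.exchange hno hl hp htp
  have hper : f^[l] (f t) ∈ periodicPts f := iterate_mem_periodicPts hex.periodic (l + 1)
  have hret : f (f^[l] (f t)) = f^[l + 1] p := by rw [← iterate_succ_apply' f, hex.return_eq]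
  obtain ⟨s, hs, hE⟩ := hbunch (f^[l] p) (f^[l] (f t)) (f^[l + 1] p) (fun hc => hp (hc ▸ hper))
    (iterate_succ_apply' f l p ▸ hf.1 _) (hret ▸ hf.1 _)
  rcases hE with hE | hE
  · obtain ⟨g, hg, hg'⟩ := hf.exists_uniqueTop_of_second_edge (hin p) hl hp hE hs
    exact hno g hg hg'
  · -- after the exchange, the cycle edge into the root becomes the last edge of the branch
    have hg := hf.1.update htp
    have hmax : IsMaximalSelection E (update f t p) := by
      refine ⟨hg, fun g' hg' => (hf.2 g' hg').trans ?_⟩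
      have := hex.ncard_add_le
      omega
    have hl' : ∀ q, (update f t p)^[l + 1] q ∈ periodicPts (update f t p) := by
      by_contra! hc
      obtain ⟨q, hq⟩ := hc
      exact hno _ hg (hex.uniqueTop_update hq)
    obtain ⟨g, hg, hg'⟩ := hmax.exists_uniqueTop_of_second_edge (p := f t) (l := l) (s := s)
      (hin _) hl' (by
        rw [hex.iterate_segment (Nat.le_succ l)]
        exact hex.segment_notMem (Nat.lt_succ_self l))
      (by rwa [hex.iterate_segment (Nat.le_succ l)])
      (by rwa [hex.iterate_segment le_rfl, hex.return_eq])
    exact hno g hg hg'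

end Selection

/-! ### Images of minimal cardinality and stable pairs -/

namespace Coloring

variable {V : Type u} [Quiver.{v} V] {C : Type*} (χ : Coloring V C)

theorem run_append (p : V) (u w : List C) : χ.run p (u ++ w) = χ.run (χ.run p u) w :=
  List.foldl_append

theorem run_replicate (p : V) (n : ℕ) (c : C) :
    χ.run p (List.replicate n c) = (fun x => χ.step x c)^[n] p := by
  induction n generalizing p with
  | zero => rfl
  | succ n ih => exact ih _

theorem step_color {a b : V} (e : a ⟶ b) : χ.step a (χ.color a ⟨b, e⟩) = b := by
  simp [step]

theorem nonempty_hom_step (p : V) (c : C) : Nonempty (p ⟶ χ.step p c) :=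
  ⟨((χ.color p).symm c).2⟩

theorem exists_run_eq {a b : V} (c : Quiver.Path a b) : ∃ u, χ.run a u = b := by
  induction c with
  | nil => exact ⟨[], rfl⟩
  | @cons b c _ e ih =>
    obtain ⟨u, hu⟩ := ih
    refine ⟨u ++ [χ.color b ⟨c, e⟩], ?_⟩
    rw [run_append, hu]
    exact χ.step_color e

theorem Stable.of_forall {χ : Coloring V C} {p q : V}
    (h : ∀ u, χ.Synchronizing (χ.run p u) (χ.run q u)) : χ.Stable p q :=
  ⟨h [], h⟩

/-- `S` is the image of the set of all states under a word, and no word has a smaller image. -/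
def IsMinimalImage (S : Set V) : Prop :=
  (∃ w, S = Set.range fun x => χ.run x w) ∧ ∀ w, S.ncard ≤ (Set.range fun x => χ.run x w).ncard

theorem exists_isMinimalImage : ∃ S, χ.IsMinimalImage S := by
  obtain ⟨w, hw⟩ := WellFounded.has_min
    (measure fun w : List C => (Set.range fun x => χ.run x w).ncard).wf Set.univ ⟨[], trivial⟩
  exact ⟨_, ⟨w, rfl⟩, fun w' => not_lt.1 (hw.2 w' trivial)⟩

namespace IsMinimalImage

variable {χ} [Finite V] {S T : Set V}

theorem image_and_injOn (hS : χ.IsMinimalImage S) (u : List C) :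
    χ.IsMinimalImage ((fun x => χ.run x u) '' S) ∧ Set.InjOn (fun x => χ.run x u) S := by
  obtain ⟨⟨w, rfl⟩, hmin⟩ := hS
  have himg : (fun x => χ.run x u) '' (Set.range fun x => χ.run x w) =
      Set.range fun x => χ.run x (w ++ u) := by
    rw [← Set.range_comp]
    simp only [Function.comp_def, run_append]
  have hle := Set.ncard_image_le (f := fun x => χ.run x u)
    (Set.toFinite (Set.range fun x => χ.run x w))
  refine ⟨⟨⟨_, himg⟩, fun w' => hle.trans (hmin w')⟩, Set.injOn_of_ncard_image_eq ?_⟩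
  exact hle.antisymm (himg ▸ hmin _)

/-- Two minimal images that differ in a single state each give a stable pair: otherwise the union of
their images under some word would consist of pairwise non-synchronizing states, and be too large
to fit into a minimal image. -/
theorem stable [Nonempty C] (hS : χ.IsMinimalImage S) (hT : χ.IsMinimalImage T) {p q : V}
    (hp : p ∈ S) (hq : q ∈ T) (hST : ∀ x ∈ S, x ≠ p → x ∈ T ∧ x ≠ q) : χ.Stable p q := by
  refine Stable.of_forall fun u => ?_
  obtain ⟨w, hw⟩ := hS.1
  obtain ⟨c⟩ := ‹Nonempty C›
  -- a nonempty word whose image is minimal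
  have hs := (hS.image_and_injOn [c]).1
  have hwc : ((fun x => χ.run x [c]) '' S) = Set.range fun x => χ.run x (w ++ [c]) := by
    rw [hw, ← Set.range_comp]
    simp only [Function.comp_def, run_append]
  rw [hwc] at hs
  refine ⟨w ++ [c], by simp, ?_⟩
  have himg : (fun x => χ.run x (u ++ (w ++ [c]))) '' S = Set.range fun x => χ.run x (w ++ [c]) := by
    refine Set.eq_of_subset_of_ncard_le ?_ ?_ (Set.toFinite _)
    · rintro _ ⟨x, -, rfl⟩
      exact ⟨χ.run x u, (χ.run_append _ _ _).symm⟩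
    · obtain ⟨w', hw'⟩ := (hS.image_and_injOn (u ++ (w ++ [c]))).1.1
      rw [hw']
      exact hs.2 w'
  obtain ⟨x, hx, hxq⟩ : χ.run q (u ++ (w ++ [c])) ∈ (fun x => χ.run x (u ++ (w ++ [c]))) '' S := by
    rw [himg, run_append]
    exact ⟨_, rfl⟩
  by_cases hxp : x = p
  · subst hxp
    simpa only [run_append] using hxq
  · exact absurd ((hT.image_and_injOn _).2 (hST x hx hxp).1 hq hxq) (hST x hx hxp).2

end IsMinimalImage

/-- If the vertices of maximal level of some letter lie in one tree, then a minimal image contains at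
most one of them. Moving a minimal image with such a vertex down to level one yields a minimal image
with a single state off the cycles, and the letter's powers that fix the cycles move just this
state. -/
theorem exists_stable_of_uniqueTop [Finite V] (hconn : Quiver.IsStronglyConnected V) (c : C)
    (h : UniqueTop fun x => χ.step x c) : ∃ p q, p ≠ q ∧ χ.Stable p q := by
  have : Nonempty C := ⟨c⟩
  have := Fintype.ofFinite V
  obtain ⟨L, r, p, hr, hp, htop⟩ := h
  obtain ⟨S, hS, hpS⟩ : ∃ S, χ.IsMinimalImage S ∧ p ∈ S := by
    obtain ⟨S, hS⟩ := χ.exists_isMinimalImage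
    obtain ⟨w, hw⟩ := hS.1
    obtain ⟨u, hu⟩ := χ.exists_run_eq (hconn (χ.run p w) p).some
    exact ⟨_, (hS.image_and_injOn u).1, χ.run p w, hw ▸ ⟨p, rfl⟩, hu⟩
  set f : V → V := fun x => χ.step x c
  have hpow : ∀ {S}, χ.IsMinimalImage S → ∀ n, χ.IsMinimalImage (f^[n] '' S) ∧ Set.InjOn f^[n] S :=
    fun hS n => by
      have := hS.image_and_injOn (List.replicate n c)
      simpa only [run_replicate] using this
  -- in `f^[L] '' S` all states other than `f^[L] p` are periodic, because `f` is injective there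
  -- and maps all non-periodic ones to `r`
  have hS' := (hpow hS L).1
  have hinj := (hpow hS' 1).2
  rw [iterate_one] at hinj
  -- a positive multiple of the lengths of all cycles
  set N := (Fintype.card V).factorial
  have hT := hpow hS' N
  have hfix : ∀ x ∈ periodicPts f, f^[N] x = x :=
    fun x hx => isPeriodicPt_factorial_card_of_mem_periodicPts hx
  have hp' : f^[L] p ∈ f^[L] '' S := ⟨p, hpS, rfl⟩
  have hper : f^[N] (f^[L] p) ∈ periodicPts f := by
    refine iterate_mem_periodicPts_of_le (m := 1) (Nat.factorial_pos _) ?_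
    rw [iterate_one, ← iterate_succ_apply' f, htop p hp]
    exact hr
  refine ⟨f^[L] p, f^[N] (f^[L] p), fun hc => hp (hc ▸ hper),
    hS'.stable hT.1 hp' ⟨_, hp', rfl⟩ fun x hx hne => ?_⟩
  have hxper : x ∈ periodicPts f := by
    obtain ⟨z, hz, rfl⟩ := hx
    by_contra hc
    refine hne (hinj ⟨z, hz, rfl⟩ hp' ?_)
    rw [← iterate_succ_apply' f, ← iterate_succ_apply' f, htop z hc, htop p hp]
  refine ⟨⟨x, hx, hfix x hxper⟩, fun hc => hne (hT.2 hx hp' ?_)⟩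
  rw [hfix x hxper, hc]

end Coloring

/-! ### Colorings of AGW graphs -/

section Graph

variable {V : Type u} [Quiver.{v} V]

theorem exists_hom_of_path_of_ne {a b : V} (c : Quiver.Path a b) (h : a ≠ b) :
    (∃ y, Nonempty (a ⟶ y)) ∧ ∃ x, Nonempty (x ⟶ b) := by
  induction c with
  | nil => exact absurd rfl h
  | @cons b c _ e ih =>
    refine ⟨?_, b, ⟨e⟩⟩
    by_cases hab : a = b
    · subst hab
      exact ⟨c, ⟨e⟩⟩
    · exact (ih hab).1

/-- Any selection of one outgoing edge at every vertex is the action of a letter. -/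
theorem exists_coloring_step_eq {d : ℕ} (hfin : ∀ a : V, Finite (Quiver.Star a))
    (hcard : ∀ a : V, Nat.card (Quiver.Star a) = d) (c : Fin d) {f : V → V}
    (hf : ∀ x, Nonempty (x ⟶ f x)) : ∃ χ : Coloring V (Fin d), ∀ x, χ.step x c = f x := by
  let ε := fun x => Finite.equivFinOfCardEq (hcard x)
  refine ⟨⟨fun x => (ε x).trans (Equiv.swap (ε x ⟨f x, (hf x).some⟩) c)⟩, fun x => ?_⟩
  simp [Coloring.step]

theorem iterate_length_eq {f : V → V} (hf : ∀ x y : V, (x ⟶ y) → y = f x) {a b : V}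
    (c : Quiver.Path a b) : f^[c.length] a = b := by
  induction c with
  | nil => rfl
  | cons _ e ih => rw [Quiver.Path.length_cons, iterate_succ_apply', ih, ← hf _ _ e]

/-- An AGW graph with several vertices is not a cycle with multiple edges, because the length of
such a cycle divides the lengths of all closed paths. -/
theorem IsAGW.exists_hom_ne [Nontrivial V] {d : ℕ} (hV : IsAGW V d) {f : V → V}
    (hf : ∀ q, q ∈ periodicPts f) : ∃ x s, Nonempty (x ⟶ s) ∧ s ≠ f x := by
  by_contra! hc
  have hc' : ∀ x y : V, (x ⟶ y) → y = f x := fun x y e => hc x y ⟨e⟩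
  obtain ⟨a, b, hab⟩ := exists_pair_ne V
  have hiter : ∀ y, ∃ n, f^[n] a = y := fun y =>
    ⟨_, iterate_length_eq hc' (hV.strongly_connected a y).some⟩
  have hone : minimalPeriod f a = 1 := hV.gcd_cycles _ fun y c => by
    obtain ⟨n, rfl⟩ := hiter y
    rw [← minimalPeriod_apply_iterate (hf a) n]
    exact IsPeriodicPt.minimalPeriod_dvd (iterate_length_eq hc' c)
  obtain ⟨n, hn⟩ := hiter b
  exact hab (by rw [← hn, iterate_fixed (minimalPeriod_eq_one_iff_isFixedPt.1 hone)])

end Graph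

end RoadColoring

open RoadColoring in
theorem theoremt1 (V : Type u) [Quiver.{v} V] [Nontrivial V] (d : ℕ)
    (hV : RoadColoring.IsAGW V d) :
    ∃ (χ : RoadColoring.Coloring V (Fin d)) (p q : V), p ≠ q ∧ χ.Stable p q := by
  classical
  have := hV.finite_vertices
  have := hV.finite_edges
  have hfin : ∀ a : V, Finite (Quiver.Star a) := fun a =>
    inferInstanceAs (Finite (Σ b, a ⟶ b))
  have hout : ∀ x : V, ∃ y, Nonempty (x ⟶ y) := fun x =>
    let ⟨y, hy⟩ := exists_ne x
    (exists_hom_of_path_of_ne (hV.strongly_connected x y).some hy.symm).1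
  have hin : ∀ y : V, ∃ x, Nonempty (x ⟶ y) := fun y =>
    let ⟨x, hx⟩ := exists_ne y
    (exists_hom_of_path_of_ne (hV.strongly_connected x y).some hx).2
  have hd : 0 < d := by
    obtain ⟨x⟩ := (inferInstance : Nonempty V)
    obtain ⟨y, ⟨e⟩⟩ := hout x
    have : Nonempty (Quiver.Star x) := ⟨⟨y, e⟩⟩
    exact hV.outdegree x ▸ Nat.card_pos
  let c : Fin d := ⟨0, hd⟩
  by_cases hbunch : ∀ x y r : V, x ≠ y → Nonempty (x ⟶ r) → Nonempty (y ⟶ r) →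
      ∃ s, s ≠ r ∧ (Nonempty (x ⟶ s) ∨ Nonempty (y ⟶ s))
  · obtain ⟨f, hf, htop⟩ := exists_isSelection_uniqueTop hout hin
      (fun f _ => hV.exists_hom_ne) hbunch
    obtain ⟨χ, hχ⟩ := exists_coloring_step_eq hfin hV.outdegree c hf
    have hstep : (fun x => χ.step x c) = f := funext hχ
    exact ⟨χ, χ.exists_stable_of_uniqueTop hV.strongly_connected c (hstep ▸ htop)⟩
  · -- all edges from `p` and from `q` end at `r`, so that every letter synchronizes `p` and `q`
    push Not at hbunch
    obtain ⟨p, q, r, hpq, -, -, hr⟩ := hbunch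
    choose f hf using hout
    obtain ⟨χ, -⟩ := exists_coloring_step_eq hfin hV.outdegree c hf
    have hp : ∀ a, χ.step p a = r := fun a => by
      by_contra hc
      exact (hr _ hc).1.false (χ.nonempty_hom_step p a).some
    have hq : ∀ a, χ.step q a = r := fun a => by
      by_contra hc
      exact (hr _ hc).2.false (χ.nonempty_hom_step q a).some
    refine ⟨χ, p, q, hpq, Coloring.Stable.of_forall fun u => ⟨[c], by simp, ?_⟩⟩
    cases u with
    | nil => exact (hp c).trans (hq c).symm
    | cons a u =>
      change χ.run (χ.run (χ.step p a) u) [c] = χ.run (χ.run (χ.step q a) u) [c]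
      rw [hp, hq]
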